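/- Let $p \ge 41$ be a prime, $n = 2p$, and let $\lambda = (p,p)$, a partition of $n$. Let $\chi_\lambda$ be the irreducible complex character of the symmetric group $S_n$ attached to $\lambda$ (the character of the Specht module $S^\lambda$), and let $D_n = \langle r, s\rangle \le S_n$ be the dihedral subgroup of order $2n$ generated by $r = (1\,2\,\dots\,n)$ and $s = (1\;n)(2\;n-1)\cdots(p\;\,p+1)$. Then for every irreducible complex character $\psi$ of $D_n$, $$\big\langle \mathrm{Res}^{S_n}_{D_n}\chi_\lambda,\ \psi\big\rangle > n,$$ where $\langle \varphi,\psi\rangle = \frac{1}{|D_n|}\sum_{g\in D_n}\varphi(g)\overline{\psi(g)}$; that is, $\psi$ occurs in the restriction of $\chi_\lambda$ to $D_n$ with multiplicity greater than $n$. -/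

import Mathlib

noncomputable section

/-- A Young tableau of shape `μ` with entries `0, …, n - 1`, each used once: the entry `a` is
placed in the cell `T a = (row, column)`. There is none unless `μ` has exactly `n` cells. -/
abbrev Tableau (n : ℕ) (μ : YoungDiagram) : Type := Fin n ≃ μ.cells

/-- A tabloid of shape `μ` (a tableau up to reordering its rows), recorded as the map that sends
each entry to its row; exactly `μ.rowLen i` entries lie in row `i`. -/
def Tabloid (n : ℕ) (μ : YoungDiagram) : Type :=
  {f : Fin n → ℕ // ∀ i : ℕ, Nat.card {a : Fin n // f a = i} = μ.rowLen i}

namespace Tabloid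

variable {n : ℕ} {μ : YoungDiagram}

/-- `S_n` acts on tabloids by permuting the entries: the entry `g a` of `g • f` lies in the row
in which the entry `a` of `f` lies. -/
instance : MulAction (Equiv.Perm (Fin n)) (Tabloid n μ) where
  smul g f := ⟨fun a => f.1 (g⁻¹ a), fun i => by
    rw [← f.2 i]
    exact Nat.card_congr
      (g⁻¹.subtypeEquiv (p := fun a => f.1 (g⁻¹ a) = i) (q := fun a => f.1 a = i)
        fun _ => Iff.rfl)⟩
  one_smul _ := rfl
  mul_smul g h f := Subtype.ext <| funext fun a => by
    change f.1 ((g * h)⁻¹ a) = f.1 (h⁻¹ (g⁻¹ a))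
    rw [mul_inv_rev, Equiv.Perm.mul_apply]

end Tabloid

namespace Tableau

variable {n : ℕ} {μ : YoungDiagram}

/-- The tabloid `{T}` of a tableau `T`. -/
def tabloid (T : Tableau n μ) : Tabloid n μ :=
  ⟨fun a => (T a).1.1, fun i => by
    rw [YoungDiagram.rowLen_eq_card, ← Fintype.card_coe, ← Nat.card_eq_fintype_card]
    exact Nat.card_congr
      { toFun := fun a => ⟨(T a.1).1, by
          simp [YoungDiagram.mem_row_iff, a.2]⟩
        invFun := fun c => ⟨T.symm ⟨c.1, by
          have := c.2
          rw [YoungDiagram.mem_row_iff] at this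
          exact this.1⟩, by
          have := c.2
          rw [YoungDiagram.mem_row_iff] at this
          simpa using this.2⟩
        left_inv := fun a => by simp
        right_inv := fun c => by simp }⟩

/-- `g` belongs to the column stabilizer of `T`: it maps every entry to an entry in the same
column. -/
def PreservesColumns (T : Tableau n μ) (g : Equiv.Perm (Fin n)) : Prop :=
  ∀ a, (T (g a)).1.2 = (T a).1.2

open scoped Classical in
/-- The polytabloid `e_T = ∑ sgn(g) {g T}`, the sum over the column stabilizer of `T`. -/
def polytabloid (T : Tableau n μ) : MonoidAlgebra ℂ (Tabloid n μ) :=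
  ∑ g : Equiv.Perm (Fin n) with T.PreservesColumns g,
    MonoidAlgebra.single (g • T.tabloid) (((Equiv.Perm.sign g : ℤ) : ℂ))

theorem ofMulAction_polytabloid (h : Equiv.Perm (Fin n)) (T : Tableau n μ) :
    Representation.ofMulAction ℂ (Equiv.Perm (Fin n)) (Tabloid n μ) h (polytabloid T) =
      polytabloid (h⁻¹.trans T : Tableau n μ) := by
  classical
  have key : tabloid (h⁻¹.trans T : Tableau n μ) = h • tabloid T := rfl
  simp only [polytabloid, map_sum, Representation.ofMulAction_single, key]
  refine Finset.sum_equiv (MulAut.conj h).toEquiv ?_ ?_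
  · intro g
    rw [Finset.mem_filter_univ, Finset.mem_filter_univ]
    constructor
    · intro hg a
      simpa [PreservesColumns] using hg (h⁻¹ a)
    · intro hg a
      simpa [PreservesColumns] using hg (h a)
  · intro g _
    rcases Int.units_eq_one_or (Equiv.Perm.sign h) with hs | hs <;>
      simp [smul_smul, mul_assoc, hs]

end Tableau

/-- The Specht module `S^μ`: the span of all polytabloids in the permutation module on tabloids,
as a subrepresentation of that module. -/
def spechtSubrepresentation (n : ℕ) (μ : YoungDiagram) :
    Subrepresentation
      (Representation.ofMulAction ℂ (Equiv.Perm (Fin n)) (Tabloid n μ)) where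
  toSubmodule := Submodule.span ℂ (Set.range (Tableau.polytabloid (n := n) (μ := μ)))
  apply_mem_toSubmodule g v hv := by
    induction hv using Submodule.span_induction with
    | mem x hx =>
      obtain ⟨T, rfl⟩ := hx
      rw [Tableau.ofMulAction_polytabloid]
      exact Submodule.subset_span ⟨_, rfl⟩
    | zero => simp
    | add x y _ _ hx hy => rw [map_add]; exact add_mem hx hy
    | smul c x _ hx => rw [map_smul]; exact Submodule.smul_mem _ c hx

/-- The trace below is a genuine one: Specht modules are finite-dimensional. -/
instance (n : ℕ) (μ : YoungDiagram) :
    FiniteDimensional ℂ (spechtSubrepresentation n μ).toSubmodule :=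
  FiniteDimensional.span_of_finite ℂ (Set.finite_range _)

/-- The irreducible character `χ_μ` of `S_n` attached to a partition `μ` of `n`: the character of
the Specht module `S^μ`. -/
def symmetricCharacter (n : ℕ) (μ : YoungDiagram) : Equiv.Perm (Fin n) → ℂ :=
  (spechtSubrepresentation n μ).toRepresentation.character

/-- The dihedral subgroup `D_n = ⟨r, s⟩` of `S_n`, on the points `0, …, n - 1`: here
`r = (0 1 … n-1)` and `s` is the reflection `i ↦ n - 1 - i`. -/
def dihedralSubgroup (n : ℕ) : Subgroup (Equiv.Perm (Fin n)) :=
  Subgroup.closure {finRotate n, Fin.revPerm}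

/-- The scalar product `⟨φ, ψ⟩ = |G|⁻¹ ∑ φ(g) conj ψ(g)` of complex functions on a finite
group. -/
def characterInner {G : Type*} [Group G] [Finite G] (φ ψ : G → ℂ) : ℂ :=
  letI := Fintype.ofFinite G
  (Nat.card G : ℂ)⁻¹ * ∑ g : G, φ g * (starRingEnd ℂ) (ψ g)

end

noncomputable section

/-! The restriction of the Specht module to `D_n` contains a free `ℂ[D_n]`-module of rank greater
than `n`. Every irreducible occurs in the regular representation, so its multiplicity is at least
that rank (`Representation.card_le_finrank_invariants_linHom`).

Up to sign, a polytabloid of shape `(p,p)` depends only on the perfect matching of the `n`-gon whose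
arcs are the columns. Its lexicographically least tabloid records the smaller endpoints of the arcs,
and these determine a noncrossing matching; hence distinct noncrossing matchings give independent
polytabloids. `D_n` permutes noncrossing matchings, so free orbits of them yield a free module.

The matchings used consist of three bundles of `a < b < c` nested arcs, `a + b + c = p`. The
distances between the bundle centres are `a + b`, `b + c`, `c + a` in cyclic order. They are
distinct, so no nontrivial rotation or reflection relates two such matchings
(`blockMatching_rigid`). There are more than `2 p` such triples once `p ≥ 41`. -/

/-- Vectors with a triangular family of functionals are linearly independent. -/
theorem linearIndependent_of_triangular {ι k M L : Type*} [Field k] [AddCommGroup M] [Module k M]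
    [LinearOrder L] (v : ι → M) (φ : ι → M →ₗ[k] k) (ℓ : ι → L) (hℓ : Function.Injective ℓ)
    (hne : ∀ i, φ i (v i) ≠ 0) (hle : ∀ i j, φ i (v j) ≠ 0 → ℓ j ≤ ℓ i) :
    LinearIndependent k v := by
  classical
  rw [linearIndependent_iff']
  intro s g hsum
  by_contra! hcon
  obtain ⟨i₀, hi₀, hgi₀⟩ := hcon
  -- `φ i` sees only vectors of level at most `ℓ i`, so at the least level with nonzero coefficient
  -- it isolates one term.
  obtain ⟨i, hi, hmin⟩ := Finset.exists_min_image (s.filter fun i => g i ≠ 0) ℓ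
    ⟨i₀, Finset.mem_filter.2 ⟨hi₀, hgi₀⟩⟩
  rw [Finset.mem_filter] at hi
  have h := congrArg (φ i) hsum
  rw [map_sum, map_zero, Finset.sum_eq_single_of_mem i hi.1] at h
  · rw [map_smul, smul_eq_mul] at h
    exact (mul_ne_zero hi.2 (hne i)) h
  · intro j hj hji
    rw [map_smul, smul_eq_mul]
    by_contra hprod
    have hgj := left_ne_zero_of_mul hprod
    have h1 := hle i j (right_ne_zero_of_mul hprod)
    have h2 := hmin j (Finset.mem_filter.2 ⟨hj, hgj⟩)
    exact hji (hℓ (le_antisymm h1 h2))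

/-! ### Characters of finite groups and free submodules -/

open scoped ComplexOrder in
/-- The value of the character of a complex representation of a finite group at an inverse is the
complex conjugate. -/
theorem Representation.star_character {G W : Type*} [Group G] [Finite G] [AddCommGroup W]
    [Module ℂ W] [FiniteDimensional ℂ W] (σ : Representation ℂ G W) (g : G) :
    (starRingEnd ℂ) (σ.character g) = σ.character g⁻¹ := by
  classical
  let := Fintype.ofFinite G
  let b := Module.finBasis ℂ W
  let A : G → Matrix (Fin (Module.finrank ℂ W)) (Fin (Module.finrank ℂ W)) ℂ :=
    fun g => LinearMap.toMatrix b b (σ g)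
  have hmul : ∀ g h, A (g * h) = A g * A h := fun g h => by
    simp only [A, map_mul]
    exact LinearMap.toMatrix_mul b _ _
  have hone : A 1 = 1 := by simp [A]
  have htr : ∀ g, σ.character g = (A g).trace := fun g =>
    LinearMap.trace_eq_matrix_trace ℂ b (σ g)
  -- An invariant Hermitian form, by averaging; the term `h = 1` makes it positive definite.
  let P := ∑ h : G, (A h).conjTranspose * A h
  have hP : P.PosDef := by
    have : P = (A 1).conjTranspose * A 1 +
        ∑ h ∈ Finset.univ.erase (1 : G), (A h).conjTranspose * A h :=
      (Finset.add_sum_erase _ _ (Finset.mem_univ 1)).symm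
    rw [this, hone]
    refine Matrix.PosDef.add_posSemidef (by simpa using Matrix.PosDef.one) ?_
    exact Matrix.posSemidef_sum _ fun h _ => Matrix.posSemidef_conjTranspose_mul_self _
  have hinv : (A g).conjTranspose * P * A g = P := by
    simp only [P, Finset.mul_sum, Finset.sum_mul]
    refine Fintype.sum_equiv (Equiv.mulRight g) _ _ fun h => ?_
    simp [hmul, Matrix.mul_assoc]
  have hg : A g * A g⁻¹ = 1 := by rw [← hmul, mul_inv_cancel, hone]
  have hdet : IsUnit P.det := (Matrix.isUnit_iff_isUnit_det _).1 hP.isUnit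
  have h1 : (A g).conjTranspose * P = P * A g⁻¹ := by
    calc (A g).conjTranspose * P = (A g).conjTranspose * P * (A g * A g⁻¹) := by rw [hg, mul_one]
      _ = (A g).conjTranspose * P * A g * A g⁻¹ := by simp only [Matrix.mul_assoc]
      _ = P * A g⁻¹ := by rw [hinv]
  rw [htr, htr, starRingEnd_apply, ← Matrix.trace_conjTranspose]
  calc (A g).conjTranspose.trace = ((A g).conjTranspose * P * P⁻¹).trace := by
        rw [Matrix.mul_assoc, Matrix.mul_nonsing_inv _ hdet, mul_one]
    _ = (P⁻¹ * (P * A g⁻¹)).trace := by rw [h1, Matrix.trace_mul_comm]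
    _ = (A g⁻¹).trace := by rw [← Matrix.mul_assoc, Matrix.nonsing_inv_mul _ hdet, one_mul]

/-- If a representation `ρ` of a finite group contains vectors indexed by `ι` whose translates are
linearly independent (that is, `ρ` contains a free module of rank `|ι|`), then every nonzero
representation has at least `|ι|` independent intertwining maps to `ρ`. -/
theorem Representation.card_le_finrank_invariants_linHom {G V W ι : Type*} [Group G] [Finite G]
    [Fintype ι] [AddCommGroup V] [Module ℂ V] [FiniteDimensional ℂ V] [AddCommGroup W]
    [Module ℂ W] [FiniteDimensional ℂ W] [Nontrivial W] (σ : Representation ℂ G W)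
    (ρ : Representation ℂ G V) (v : ι → V)
    (hv : LinearIndependent ℂ fun x : G × ι => ρ x.1 (v x.2)) :
    Fintype.card ι ≤ Module.finrank ℂ (σ.linHom ρ).invariants := by
  classical
  let := Fintype.ofFinite G
  obtain ⟨w₀, hw₀⟩ := exists_ne (0 : W)
  obtain ⟨φ, hφ⟩ := Module.Projective.exists_dual_ne_zero ℂ hw₀
  -- The average of the rank-one map `w ↦ φ w • v i`. At `w₀` it is a combination of translates of
  -- `v i` in which `v i` itself has coefficient `φ w₀ ≠ 0`.
  let T : ι → W →ₗ[ℂ] V := fun i => ∑ g : G, (φ ∘ₗ σ g⁻¹).smulRight (ρ g (v i))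
  have hT : ∀ i, T i ∈ (σ.linHom ρ).invariants := by
    intro i h
    ext w
    simp only [T, Representation.linHom_apply, LinearMap.comp_apply, LinearMap.sum_apply,
      LinearMap.smulRight_apply, map_sum, map_smul]
    refine Fintype.sum_equiv (Equiv.mulLeft h) _ _ fun g => ?_
    simp [map_mul]
  have hLI : LinearIndependent ℂ T := by
    rw [Fintype.linearIndependent_iff] at hv ⊢
    intro c hc i
    have h := hv (fun x => c x.2 * φ (σ x.1⁻¹ w₀)) ?_ (1, i)
    · simpa [hφ] using h
    · have h0 := LinearMap.congr_fun hc w₀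
      simp only [T, LinearMap.sum_apply, LinearMap.smul_apply, LinearMap.smulRight_apply,
        LinearMap.comp_apply, LinearMap.zero_apply, Finset.smul_sum, smul_smul] at h0
      rw [Fintype.sum_prod_type_right]
      exact h0
  have hLI' : LinearIndependent ℂ
      (fun i => (⟨T i, hT i⟩ : (σ.linHom ρ).invariants)) :=
    LinearIndependent.of_comp (Submodule.subtype _) hLI
  exact hLI'.fintype_card_le_finrank

/-- The scalar product of two characters is the dimension of the space of intertwining maps. -/
theorem characterInner_character_eq_finrank {G V W : Type*} [Group G] [Finite G]
    [AddCommGroup V] [Module ℂ V] [FiniteDimensional ℂ V] [AddCommGroup W]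
    [Module ℂ W] [FiniteDimensional ℂ W] (σ : Representation ℂ G W) (ρ : Representation ℂ G V) :
    characterInner ρ.character σ.character = Module.finrank ℂ (σ.linHom ρ).invariants := by
  let := Fintype.ofFinite G
  have hG : (Nat.card G : ℂ) ≠ 0 := Nat.cast_ne_zero.2 Nat.card_pos.ne'
  let : Invertible (Nat.card G : ℂ) := invertibleOfNonzero hG
  rw [← Representation.card_inv_mul_sum_char_eq_finrank, characterInner]
  congr 1
  refine Finset.sum_congr rfl fun g _ => ?_
  rw [Representation.char_linHom, Representation.star_character, mul_comm]

theorem Equiv.Perm.apply_inv_apply {α : Type*} (g : Equiv.Perm α) (x : α) : g (g⁻¹ x) = x :=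
  g.apply_symm_apply x

/-! ### Leading tabloids of two-row polytabloids -/

namespace Tableau

variable {n : ℕ} {μ : YoungDiagram}

/-- A permutation preserving the columns of `T` is determined by the tabloid `g • {T}`. -/
theorem PreservesColumns.eq_of_smul_tabloid_eq {T : Tableau n μ} {g h : Equiv.Perm (Fin n)}
    (hg : T.PreservesColumns g) (hh : T.PreservesColumns h)
    (e : g • T.tabloid = h • T.tabloid) : g = h := by
  have key : ∀ a, g⁻¹ a = h⁻¹ a := by
    intro a
    apply T.injective
    apply Subtype.ext
    apply Prod.ext
    · exact congrFun (congrArg Subtype.val e) a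
    · have h1 := hg (g⁻¹ a)
      have h2 := hh (h⁻¹ a)
      rw [Equiv.Perm.apply_inv_apply] at h1 h2
      rw [← h1, h2]
  exact inv_injective (Equiv.ext key)

open scoped Classical in
theorem coeff_polytabloid (T : Tableau n μ) (t : Tabloid n μ) :
    T.polytabloid.coeff t = ∑ g : Equiv.Perm (Fin n) with T.PreservesColumns g,
      if g • T.tabloid = t then (((Equiv.Perm.sign g : ℤ) : ℂ)) else 0 := by
  rw [polytabloid, MonoidAlgebra.coeff_sum, Finsupp.finsetSum_apply]
  simp [Finsupp.single_apply]

/-- No cancellation occurs: distinct elements of the column stabilizer give distinct tabloids, so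
the coefficient is a sign. -/
theorem coeff_polytabloid_smul_tabloid {T : Tableau n μ} {g : Equiv.Perm (Fin n)}
    (hg : T.PreservesColumns g) :
    T.polytabloid.coeff (g • T.tabloid) ≠ 0 := by
  classical
  rw [coeff_polytabloid, Finset.sum_eq_single_of_mem g (by simpa using hg)]
  · simp
  · intro h hh hne
    rw [if_neg]
    exact fun e => hne ((by simpa using hh : T.PreservesColumns h).eq_of_smul_tabloid_eq hg e)

theorem exists_of_coeff_polytabloid_ne_zero {T : Tableau n μ} {t : Tabloid n μ}
    (ht : T.polytabloid.coeff t ≠ 0) :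
    ∃ g, T.PreservesColumns g ∧ g • T.tabloid = t := by
  classical
  rw [coeff_polytabloid] at ht
  obtain ⟨g, hg, hne⟩ := Finset.exists_ne_zero_of_sum_ne_zero ht
  exact ⟨g, by simpa using hg, by_contra fun e => hne (if_neg e)⟩

end Tableau

/-- The row pattern placing the smaller element of each orbit of an involution `f` in row `0` and
the larger one in row `1`. -/
def openerPattern {n : ℕ} (f : Fin n → Fin n) (x : Fin n) : ℕ := if x < f x then 0 else 1

namespace Tableau

variable {n : ℕ} {μ : YoungDiagram}

/-- If the columns of a two-row tableau are the orbits of a fixed-point-free involution `f`, its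
polytabloid involves the tabloid with row pattern `openerPattern f`, and this is
lexicographically the least tabloid it involves. -/
theorem exists_leading_tabloid (hμ : ∀ c ∈ μ.cells, c.1 < 2) (T : Tableau n μ)
    (f : Fin n → Fin n) (hf : ∀ x, f (f x) = x) (hne : ∀ x, f x ≠ x)
    (hcol : ∀ x, (T (f x)).1.2 = (T x).1.2) :
    ∃ t : Tabloid n μ, t.1 = openerPattern f ∧ T.polytabloid.coeff t ≠ 0 ∧
      ∀ t' : Tabloid n μ, T.polytabloid.coeff t' ≠ 0 → toLex t.1 ≤ toLex t'.1 := by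
  have hrow : ∀ x, (T (f x)).1.1 ≠ (T x).1.1 := fun x e =>
    hne x (T.injective (Subtype.ext (Prod.ext e (hcol x))))
  have hlt : ∀ x, (T x).1.1 < 2 := fun x => hμ _ (T x).2
  -- Swap the two entries of exactly those columns whose smaller entry is not in row `0`.
  let s : Fin n → Fin n := fun x => if (x < f x ↔ (T x).1.1 = 0) then x else f x
  have hs : Function.Involutive s := by
    intro x
    have h1 := hlt x
    have h2 := hlt (f x)
    have h3 := hrow x
    have h4 := hne x
    by_cases h : x < f x ↔ (T x).1.1 = 0
    · simp [s, h]
    · have h' : ¬ (f x < x ↔ (T (f x)).1.1 = 0) := by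
        have : (T (f x)).1.1 = 0 ↔ ¬ (T x).1.1 = 0 := by omega
        rw [this]
        have : f x < x ↔ ¬ x < f x := by omega
        tauto
      simp [s, h, hf, h']
  have hscol : T.PreservesColumns hs.toPerm := by
    intro x
    change (T (s x)).1.2 = _
    by_cases h : x < f x ↔ (T x).1.1 = 0 <;> simp [s, h, hcol]
  have hpat : (hs.toPerm • T.tabloid).1 = openerPattern f := by
    funext x
    change (T (hs.toPerm⁻¹ x)).1.1 = _
    have : hs.toPerm⁻¹ x = s x := by
      rw [Equiv.Perm.inv_eq_iff_eq]; exact (hs x).symm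
    rw [this]
    have h1 := hlt x
    have h2 := hlt (f x)
    have h3 := hrow x
    by_cases h : x < f x ↔ (T x).1.1 = 0
    · simp only [s, h, if_true, openerPattern]
      split_ifs with h5 <;> omega
    · simp only [s, h, if_false, openerPattern]
      by_cases h5 : x < f x
      · rw [if_pos h5]; have : ¬ (T x).1.1 = 0 := by tauto
        omega
      · rw [if_neg h5]; have : (T x).1.1 = 0 := by tauto
        omega
  refine ⟨hs.toPerm • T.tabloid, hpat, coeff_polytabloid_smul_tabloid hscol, fun t' ht' => ?_⟩
  obtain ⟨g, hg, rfl⟩ := exists_of_coeff_polytabloid_ne_zero ht'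
  rw [hpat]
  by_contra hlex
  -- At the first difference, `i` is a larger endpoint lying in row `0`. Its partner `f i` comes
  -- earlier, so it also lies in row `0`, and two entries share a cell.
  obtain ⟨i, heq, hi⟩ := not_le.1 hlex
  have hcolinv : ∀ x, (T (g⁻¹ x)).1.2 = (T x).1.2 := fun x => by
    simpa using (hg (g⁻¹ x)).symm
  change (T (g⁻¹ i)).1.1 < openerPattern f i at hi
  unfold openerPattern at hi
  have hfi : ¬ i < f i := fun h => by rw [if_pos h] at hi; omega
  rw [if_neg hfi] at hi
  have hfi' : f i < i := lt_of_le_of_ne (not_lt.1 hfi) (hne i)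
  have hj : (T (g⁻¹ (f i))).1.1 = openerPattern f (f i) := heq (f i) hfi'
  rw [openerPattern, if_pos (by rw [hf]; exact hfi')] at hj
  have : g⁻¹ (f i) = g⁻¹ i := T.injective (Subtype.ext (Prod.ext (by omega)
    (by rw [hcolinv, hcolinv, hcol])))
  exact hne i (g⁻¹.injective this)

/-- Polytabloids of two-row tableaux whose columns are the orbits of fixed-point-free involutions
with distinct opener patterns are linearly independent. -/
theorem linearIndependent_polytabloid {ι : Type*} (hμ : ∀ c ∈ μ.cells, c.1 < 2)
    (T : ι → Tableau n μ) (f : ι → Fin n → Fin n) (hf : ∀ i x, f i (f i x) = x)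
    (hne : ∀ i x, f i x ≠ x) (hcol : ∀ i x, (T i (f i x)).1.2 = (T i x).1.2)
    (hinj : Function.Injective fun i => openerPattern (f i)) :
    LinearIndependent ℂ fun i => (T i).polytabloid := by
  choose t ht hcoeff hmin using fun i =>
    exists_leading_tabloid hμ (T i) (f i) (hf i) (hne i) (hcol i)
  refine linearIndependent_of_triangular _
    (fun i => Finsupp.lapply (t i) ∘ₗ (MonoidAlgebra.coeffLinearEquiv ℂ).toLinearMap)
    (fun i => toLex (t i).1) ?_ hcoeff fun i j h => hmin j (t i) h
  intro i j h
  apply hinj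
  simpa [ht] using h

end Tableau

/-! ### Noncrossing matchings and dihedral symmetries -/

/-- A noncrossing perfect matching of `0, …, n - 1`, given as a fixed-point-free involution. -/
structure IsNoncrossingMatching {n : ℕ} (f : Fin n → Fin n) : Prop where
  apply_apply : ∀ x, f (f x) = x
  apply_ne : ∀ x, f x ≠ x
  noncrossing : ∀ x y, x < y → y < f x → ¬ f x < f y

/-- A noncrossing matching is determined by the set of smaller endpoints of its arcs. -/
theorem IsNoncrossingMatching.eq_of_openerPattern_eq {n : ℕ} {f g : Fin n → Fin n}
    (hf : IsNoncrossingMatching f) (hg : IsNoncrossingMatching g)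
    (h : openerPattern f = openerPattern g) : f = g := by
  have hiff : ∀ x, x < f x ↔ x < g x := by
    intro x
    have := congrFun h x
    unfold openerPattern at this
    split_ifs at this <;> tauto
  -- If `f j < g j < j`, then `g j` opens an `f`-arc nested inside that of `j`. This arc closes
  -- before `j`, where `f` and `g` already agree, so `g j` would have two `g`-partners.
  have aux : ∀ (f g : Fin n → Fin n), IsNoncrossingMatching f → IsNoncrossingMatching g →
      (∀ x, x < f x ↔ x < g x) → ∀ j, (∀ k < j, f k < k → f k = g k) → f j < j →
      ¬ f j < g j := by
    intro f g hf hg hiff j ih hj hlt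
    have hgj : g j < j := by
      have := hiff j
      have := hg.apply_ne j
      omega
    have h1 : g j < f (g j) := by rw [hiff, hg.apply_apply]; exact hgj
    have h2 := hf.noncrossing (f j) (g j) hlt (by rw [hf.apply_apply]; exact hgj)
    rw [hf.apply_apply, not_lt] at h2
    have h3 : f (g j) ≠ j := fun e => by
      have := hf.apply_apply (g j)
      rw [e] at this
      omega
    have h4 := ih (f (g j)) (lt_of_le_of_ne h2 h3) (by rw [hf.apply_apply]; exact h1)
    rw [hf.apply_apply] at h4
    exact h3 (by rw [← hg.apply_apply (f (g j)), ← h4, hg.apply_apply])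
  have closer : ∀ m : ℕ, ∀ j : Fin n, j.1 = m → f j < j → f j = g j := by
    intro m
    induction m using Nat.strong_induction_on with
    | _ m ih =>
      intro j hjm hj
      have ih' : ∀ k < j, f k < k → f k = g k := fun k hk => ih k.1 (by omega) k rfl
      have hgj : g j < j := by
        have := hiff j
        have := hg.apply_ne j
        omega
      have hfg := aux f g hf hg hiff j ih' hj
      have hgf := aux g f hg hf (fun x => (hiff x).symm) j (fun k hk hgk =>
        (ih' k hk (by have := hiff k; have := hf.apply_ne k; omega)).symm) hgj
      omega
  funext x
  rcases lt_or_gt_of_ne (hf.apply_ne x) with h1 | h1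
  · exact closer _ x rfl h1
  · have h2 := closer _ (f x) rfl (by rw [hf.apply_apply]; exact h1)
    rw [hf.apply_apply] at h2
    rw [h2, hg.apply_apply, ← h2]

/-- `h` acts on the `n`-gon `0, …, n - 1` as a rotation or a reflection. -/
def IsDihedral {n : ℕ} (h : Equiv.Perm (Fin n)) : Prop :=
  (∃ k < n, ∀ x : Fin n, (h x : ℕ) = x + k ∨ (h x : ℕ) + n = x + k) ∨
    ∃ k < n, ∀ x : Fin n, (h x : ℕ) + x = k ∨ (h x : ℕ) + x = k + n

/-- Reduces questions about group elements to linear arithmetic modulo `n`. -/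
theorem isDihedral_of_mem {n : ℕ} (hn : 0 < n) {h : Equiv.Perm (Fin n)}
    (hh : h ∈ dihedralSubgroup n) : IsDihedral h := by
  induction hh using Subgroup.closure_induction with
  | mem g hg =>
    rcases hg with rfl | rfl
    · obtain ⟨m, rfl⟩ : ∃ m, n = m + 1 := ⟨n - 1, by omega⟩
      -- For `n = 1` the shift `1` is not below `n`, so shift `0` is used.
      rcases Nat.eq_zero_or_pos m with rfl | hm
      · exact Or.inl ⟨0, by omega, fun x => by omega⟩
      · refine Or.inl ⟨1, by omega, fun x => ?_⟩
        rcases eq_or_ne x (Fin.last m) with rfl | hx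
        · right; simp
        · left; rw [coe_finRotate_of_ne_last hx]
    · refine Or.inr ⟨n - 1, by omega, fun x => Or.inl ?_⟩
      rw [Fin.revPerm_apply, Fin.val_rev]
      omega
  | one => exact Or.inl ⟨0, hn, fun x => Or.inl rfl⟩
  | mul g h _ _ hg hh =>
    rcases hg with ⟨k, hk, hg⟩ | ⟨k, hk, hg⟩ <;> rcases hh with ⟨l, hl, hh⟩ | ⟨l, hl, hh⟩
    · left
      refine ⟨if k + l < n then k + l else k + l - n, by split_ifs <;> omega, fun x => ?_⟩
      have := hg (h x); have := hh x
      rw [Equiv.Perm.mul_apply]; split_ifs <;> omega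
    · right
      refine ⟨if k + l < n then k + l else k + l - n, by split_ifs <;> omega, fun x => ?_⟩
      have := hg (h x); have := hh x
      rw [Equiv.Perm.mul_apply]; split_ifs <;> omega
    · right
      refine ⟨if l ≤ k then k - l else k + n - l, by split_ifs <;> omega, fun x => ?_⟩
      have := hg (h x); have := hh x
      rw [Equiv.Perm.mul_apply]; split_ifs <;> omega
    · left
      refine ⟨if l ≤ k then k - l else k + n - l, by split_ifs <;> omega, fun x => ?_⟩
      have := hg (h x); have := hh x
      rw [Equiv.Perm.mul_apply]; split_ifs <;> omega
  | inv g _ hg =>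
    rcases hg with ⟨k, hk, hg⟩ | ⟨k, hk, hg⟩
    · refine Or.inl ⟨if k = 0 then 0 else n - k, by split_ifs <;> omega, fun x => ?_⟩
      have := hg (g⁻¹ x)
      rw [Equiv.Perm.apply_inv_apply] at this
      split_ifs <;> omega
    · refine Or.inr ⟨k, hk, fun x => ?_⟩
      have := hg (g⁻¹ x)
      rw [Equiv.Perm.apply_inv_apply] at this
      omega

/-- Crossing depends only on cyclic order up to reversal. `c1`–`c4` are the cyclic shifts of the
condition, `d1`–`d4` those of its reversal. -/
theorem IsNoncrossingMatching.conj {n : ℕ} {f : Fin n → Fin n} (hf : IsNoncrossingMatching f)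
    {h : Equiv.Perm (Fin n)} (hh : IsDihedral h) :
    IsNoncrossingMatching fun x => h (f (h⁻¹ x)) := by
  refine ⟨fun x => by simp [hf.apply_apply], fun x e => ?_, fun x y => ?_⟩
  · exact hf.apply_ne (h⁻¹ x) (by rw [Equiv.Perm.eq_inv_iff_eq]; exact e)
  · obtain ⟨x, rfl⟩ := h.surjective x
    obtain ⟨y, rfl⟩ := h.surjective y
    simp only [Equiv.Perm.coe_inv, Equiv.symm_apply_apply]
    intro h1 h2 h3
    have c1 := hf.noncrossing x y
    have c2 := hf.noncrossing y (f x)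
    have c3 := hf.noncrossing (f x) (f y)
    have c4 := hf.noncrossing (f y) x
    simp only [hf.apply_apply] at c1 c2 c3 c4
    rcases hh with ⟨k, hk, hg⟩ | ⟨k, hk, hg⟩
    · have := hg x; have := hg y; have := hg (f x); have := hg (f y)
      omega
    · have d1 := hf.noncrossing (f y) (f x)
      have d2 := hf.noncrossing (f x) y
      have d3 := hf.noncrossing y x
      have d4 := hf.noncrossing x (f y)
      simp only [hf.apply_apply] at d1 d2 d3 d4
      have := hg x; have := hg y; have := hg (f x); have := hg (f y)
      omega

/-! ### Three-bundle matchings and their rigidity -/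

/-- The involution of `0, …, 2 (a + b + c) - 1` that reverses each of the consecutive blocks of
lengths `2 a`, `2 b`, `2 c`. -/
def blockReverse (a b c x : ℕ) : ℕ :=
  if x < 2 * a then 2 * a - 1 - x
  else if x < 2 * a + 2 * b then 4 * a + 2 * b - 1 - x
  else 4 * a + 4 * b + 2 * c - 1 - x

/-- `blockReverse` as a map on `Fin n`. -/
def blockMatching {n a b c : ℕ} (hn : n = 2 * (a + b + c)) (x : Fin n) : Fin n :=
  ⟨blockReverse a b c x, by unfold blockReverse; split_ifs <;> omega⟩

theorem isNoncrossingMatching_blockMatching {n a b c : ℕ} (hn : n = 2 * (a + b + c)) :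
    IsNoncrossingMatching (blockMatching hn) := by
  refine ⟨fun x => Fin.ext ?_, fun x e => ?_, fun x y => ?_⟩
  · simp only [blockMatching, blockReverse]
    split_ifs <;> omega
  · have := congrArg Fin.val e
    simp only [blockMatching, blockReverse] at this
    split_ifs at this <;> omega
  · simp only [Fin.lt_def, blockMatching, blockReverse]
    split_ifs <;> omega

/-- Only the innermost arc of a bundle joins neighbours; positivity of `a` and `b` excludes an arc
from `n - 1` to `0`. -/
theorem blockReverse_cyclic_succ {n a b c y z : ℕ} (ha : 0 < a) (hb : 0 < b)
    (hn : n = 2 * (a + b + c)) (hy : y < n) (h : blockReverse a b c y = z)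
    (hz : z = y + 1 ∨ z + n = y + 1) :
    y + 1 = a ∨ y + 1 = 2 * a + b ∨ y + 1 = 2 * a + 2 * b + c := by
  unfold blockReverse at h
  split_ifs at h <;> omega

theorem eq_of_lt_of_lt_of_mem_triple {s t r u v w : ℕ} (hst : s < t) (htr : t < r)
    (su : u = s ∨ u = t ∨ u = r) (sv : v = s ∨ v = t ∨ v = r) (sw : w = s ∨ w = t ∨ w = r)
    (huv : u < v) (hvw : v < w) : u = s ∧ v = t ∧ w = r := by
  omega

/-- A rotation preserves the cyclic gap sequence `a + b`, `b + c`, `c + a`. The smallest gap fixes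
where it starts. The cases say which centres wrap past `n`. -/
theorem gaps_rigid_of_rotation {n a b c a' b' c' k u v w : ℕ} (hn : n = 2 * (a + b + c))
    (hn' : n = 2 * (a' + b' + c')) (ha : 0 < a) (hab : a < b) (hbc : b < c)
    (hab' : a' < b') (hbc' : b' < c') (hk : k < n)
    (hu : u = a - 1 + k ∨ u + n = a - 1 + k)
    (hv : v = 2 * a + b - 1 + k ∨ v + n = 2 * a + b - 1 + k)
    (hw : w = 2 * a + 2 * b + c - 1 + k ∨ w + n = 2 * a + 2 * b + c - 1 + k)
    (su : u + 1 = a' ∨ u + 1 = 2 * a' + b' ∨ u + 1 = 2 * a' + 2 * b' + c')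
    (sv : v + 1 = a' ∨ v + 1 = 2 * a' + b' ∨ v + 1 = 2 * a' + 2 * b' + c')
    (sw : w + 1 = a' ∨ w + 1 = 2 * a' + b' ∨ w + 1 = 2 * a' + 2 * b' + c') :
    a = a' ∧ b = b' ∧ k = 0 := by
  have h1 : a' < 2 * a' + b' := by omega
  have h2 : 2 * a' + b' < 2 * a' + 2 * b' + c' := by omega
  have bu : u < n := by clear sv sw hu hv hw; omega
  have bv : v < n := by clear su sw hu hv hw; omega
  have bw : w < n := by clear su sv hu hv hw; omega
  rcases hu with hu | hu <;> rcases hv with hv | hv <;> rcases hw with hw | hw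
  · have := eq_of_lt_of_lt_of_mem_triple h1 h2 su sv sw (by clear su sv sw; omega)
      (by clear su sv sw; omega)
    clear h1 h2 su sv sw
    omega
  · have := eq_of_lt_of_lt_of_mem_triple h1 h2 sw su sv (by clear su sv sw; omega)
      (by clear su sv sw; omega)
    clear h1 h2 su sv sw
    omega
  · clear su sv sw h1 h2
    omega
  · have := eq_of_lt_of_lt_of_mem_triple h1 h2 sv sw su (by clear su sv sw; omega)
      (by clear su sv sw; omega)
    clear h1 h2 su sv sw
    omega
  · clear su sv sw h1 h2
    omega
  · clear su sv sw h1 h2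
    omega
  · clear su sv sw h1 h2
    omega
  · have := eq_of_lt_of_lt_of_mem_triple h1 h2 su sv sw (by clear su sv sw; omega)
      (by clear su sv sw; omega)
    clear h1 h2 su sv sw
    omega

/-- Cyclically the gaps read smallest, largest, middle; a reflection would turn this into smallest,
middle, largest. -/
theorem gaps_rigid_of_reflection {n a b c a' b' c' k u v w : ℕ} (hn : n = 2 * (a + b + c))
    (hn' : n = 2 * (a' + b' + c')) (hab : a < b) (hbc : b < c)
    (hab' : a' < b') (hbc' : b' < c') (hk : k < n)
    (hu : u + a = k ∨ u + a = k + n)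
    (hv : v + (2 * a + b) = k ∨ v + (2 * a + b) = k + n)
    (hw : w + (2 * a + 2 * b + c) = k ∨ w + (2 * a + 2 * b + c) = k + n)
    (su : u + 1 = a' ∨ u + 1 = 2 * a' + b' ∨ u + 1 = 2 * a' + 2 * b' + c')
    (sv : v + 1 = a' ∨ v + 1 = 2 * a' + b' ∨ v + 1 = 2 * a' + 2 * b' + c')
    (sw : w + 1 = a' ∨ w + 1 = 2 * a' + b' ∨ w + 1 = 2 * a' + 2 * b' + c') : False := by
  have h1 : a' < 2 * a' + b' := by omega
  have h2 : 2 * a' + b' < 2 * a' + 2 * b' + c' := by omega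
  have bu : u < n := by clear sv sw hu hv hw; omega
  have bv : v < n := by clear su sw hu hv hw; omega
  have bw : w < n := by clear su sv hu hv hw; omega
  rcases hu with hu | hu <;> rcases hv with hv | hv <;> rcases hw with hw | hw
  · have := eq_of_lt_of_lt_of_mem_triple h1 h2 sw sv su (by clear su sv sw; omega)
      (by clear su sv sw; omega)
    clear h1 h2 su sv sw
    omega
  · have := eq_of_lt_of_lt_of_mem_triple h1 h2 sv su sw (by clear su sv sw; omega)
      (by clear su sv sw; omega)
    clear h1 h2 su sv sw
    omega
  · clear su sv sw h1 h2
    omega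
  · have := eq_of_lt_of_lt_of_mem_triple h1 h2 su sw sv (by clear su sv sw; omega)
      (by clear su sv sw; omega)
    clear h1 h2 su sv sw
    omega
  · clear su sv sw h1 h2
    omega
  · clear su sv sw h1 h2
    omega
  · clear su sv sw h1 h2
    omega
  · have := eq_of_lt_of_lt_of_mem_triple h1 h2 sw sv su (by clear su sv sw; omega)
      (by clear su sv sw; omega)
    clear h1 h2 su sv sw
    omega

/-- Matchings consisting of three bundles of nested arcs, of increasing sizes `a < b < c`, are
related by a rotation or reflection only trivially. -/
theorem blockMatching_rigid {n a b c a' b' c' : ℕ} (hn : n = 2 * (a + b + c))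
    (hn' : n = 2 * (a' + b' + c')) (ha : 0 < a) (hab : a < b) (hbc : b < c) (ha' : 0 < a')
    (hab' : a' < b') (hbc' : b' < c') {h : Equiv.Perm (Fin n)} (hh : IsDihedral h)
    (hcomm : ∀ x, h (blockMatching hn x) = blockMatching hn' (h x)) :
    a = a' ∧ b = b' ∧ h = 1 := by
  have key : ∀ x y : Fin n, (y : ℕ) = x + 1 → blockMatching hn x = y →
      blockReverse a' b' c' (h x) = h y := fun x y _ e => by
    rw [← e, hcomm]; rfl
  have key' : ∀ x y : Fin n, (y : ℕ) = x + 1 → blockMatching hn x = y →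
      blockReverse a' b' c' (h y) = h x := fun x y hxy e => by
    have h1 := key x y hxy e
    have h2 : blockMatching hn' (h x) = h y := Fin.ext h1
    rw [← (isNoncrossingMatching_blockMatching hn').apply_apply (h x), h2]
    rfl
  -- The innermost arcs of the three bundles, which `h` must map to innermost arcs.
  have e1 : blockMatching hn ⟨a - 1, by omega⟩ = ⟨a, by omega⟩ := by
    apply Fin.ext; simp only [blockMatching, blockReverse]; split_ifs <;> omega
  have e2 : blockMatching hn ⟨2 * a + b - 1, by omega⟩ = ⟨2 * a + b, by omega⟩ := by
    apply Fin.ext; simp only [blockMatching, blockReverse]; split_ifs <;> omega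
  have e3 : blockMatching hn ⟨2 * a + 2 * b + c - 1, by omega⟩ = ⟨2 * a + 2 * b + c, by omega⟩ := by
    apply Fin.ext; simp only [blockMatching, blockReverse]; split_ifs <;> omega
  rcases hh with ⟨k, hk, hg⟩ | ⟨k, hk, hg⟩
  · have step : ∀ x y : Fin n, (y : ℕ) = x + 1 → blockMatching hn x = y →
        (h x : ℕ) + 1 = a' ∨ (h x : ℕ) + 1 = 2 * a' + b' ∨
          (h x : ℕ) + 1 = 2 * a' + 2 * b' + c' := fun x y hxy e =>
      blockReverse_cyclic_succ ha' (by omega) hn' (h x).2 (key x y hxy e)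
        (by have := hg x; have := hg y; omega)
    have s1 := step _ _ (by simp only; omega) e1
    have s2 := step _ _ (by simp only; omega) e2
    have s3 := step _ _ (by simp only; omega) e3
    have hfin := gaps_rigid_of_rotation hn hn' ha hab hbc hab' hbc' hk (hg ⟨a - 1, by omega⟩)
      (hg ⟨2 * a + b - 1, by omega⟩) (hg ⟨2 * a + 2 * b + c - 1, by omega⟩) s1 s2 s3
    refine ⟨hfin.1, hfin.2.1, Equiv.ext fun x => Fin.ext ?_⟩
    have := hg x
    rw [Equiv.Perm.one_apply]
    omega
  · exfalso
    -- A reflection swaps the ends of a short arc, so the right end `y` is the one tracked.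
    have step : ∀ x y : Fin n, (y : ℕ) = x + 1 → blockMatching hn x = y →
        (h y : ℕ) + 1 = a' ∨ (h y : ℕ) + 1 = 2 * a' + b' ∨
          (h y : ℕ) + 1 = 2 * a' + 2 * b' + c' := fun x y hxy e =>
      blockReverse_cyclic_succ ha' (by omega) hn' (h y).2 (key' x y hxy e)
        (by have := hg x; have := hg y; omega)
    have s1 := step _ _ (by simp only; omega) e1
    have s2 := step _ _ (by simp only; omega) e2
    have s3 := step _ _ (by simp only; omega) e3
    exact gaps_rigid_of_reflection hn hn' hab hbc hab' hbc' hk (hg ⟨a, by omega⟩)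
      (hg ⟨2 * a + b, by omega⟩) (hg ⟨2 * a + 2 * b + c, by omega⟩) s1 s2 s3

/-! ### Tableaux of shape `(p,p)` with prescribed columns -/

theorem mem_of_rowLens_eq {μ : YoungDiagram} {p : ℕ} (hμ : μ.rowLens = [p, p]) (c : ℕ × ℕ) :
    c ∈ μ.cells ↔ c.1 < 2 ∧ c.2 < p := by
  have h0 : μ.colLen 0 = 2 := by rw [← YoungDiagram.length_rowLens, hμ]; rfl
  have hr : μ.rowLen 0 = p ∧ μ.rowLen 1 = p := by
    have h := hμ
    rw [YoungDiagram.rowLens, h0] at h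
    simpa [List.range_succ] using h
  obtain ⟨i, j⟩ := c
  rw [YoungDiagram.mem_cells]
  constructor
  · intro h
    have hi : i < 2 := by
      rw [← h0, ← YoungDiagram.mem_iff_lt_colLen]
      exact μ.up_left_mem le_rfl (Nat.zero_le _) h
    rw [YoungDiagram.mem_iff_lt_rowLen] at h
    refine ⟨hi, ?_⟩
    interval_cases i <;> simp_all
  · rintro ⟨hi, hj⟩
    simp only at hi hj
    rw [YoungDiagram.mem_iff_lt_rowLen]
    interval_cases i <;> simp_all

/-- The smaller endpoint of the arc of `blockMatching` numbered `j`. -/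
def blockOpener (a b j : ℕ) : ℕ :=
  if j < a then j else if j < a + b then j + a else j + a + b

/-- The number of the arc of `blockMatching` whose smaller endpoint is `o`. -/
def blockIndex (a b o : ℕ) : ℕ :=
  if o < 2 * a then o else if o < 2 * a + 2 * b then o - a else o - a - b

theorem blockReverse_blockReverse {n a b c x : ℕ} (hn : n = 2 * (a + b + c)) (hx : x < n) :
    blockReverse a b c (blockReverse a b c x) = x :=
  congrArg Fin.val ((isNoncrossingMatching_blockMatching hn).apply_apply ⟨x, hx⟩)

theorem blockIndex_min_lt {n a b c x : ℕ} (hn : n = 2 * (a + b + c)) (hx : x < n) :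
    blockIndex a b (min x (blockReverse a b c x)) < a + b + c ∧
      blockOpener a b (blockIndex a b (min x (blockReverse a b c x))) =
        min x (blockReverse a b c x) := by
  have h : min x (blockReverse a b c x) < a ∨
      (2 * a ≤ min x (blockReverse a b c x) ∧ min x (blockReverse a b c x) < 2 * a + b) ∨
      (2 * a + 2 * b ≤ min x (blockReverse a b c x) ∧
        min x (blockReverse a b c x) < 2 * a + 2 * b + c) := by
    unfold blockReverse
    split_ifs <;> omega
  revert h
  generalize min x (blockReverse a b c x) = m
  intro h
  unfold blockOpener blockIndex
  constructor <;> split_ifs <;> omega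

theorem blockOpener_lt {n a b c j : ℕ} (hn : n = 2 * (a + b + c)) (hj : j < a + b + c) :
    blockOpener a b j < n ∧ blockOpener a b j < blockReverse a b c (blockOpener a b j) ∧
      blockIndex a b (blockOpener a b j) = j := by
  have h : (blockOpener a b j < a ∧ blockOpener a b j = j) ∨
      (2 * a ≤ blockOpener a b j ∧ blockOpener a b j < 2 * a + b ∧ blockOpener a b j = j + a) ∨
      (2 * a + 2 * b ≤ blockOpener a b j ∧ blockOpener a b j < 2 * a + 2 * b + c ∧
        blockOpener a b j = j + a + b) := by
    unfold blockOpener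
    split_ifs <;> omega
  revert h
  generalize blockOpener a b j = m
  intro h
  unfold blockReverse blockIndex
  refine ⟨by omega, ?_, ?_⟩ <;> split_ifs <;> omega

/-- A two-row tableau whose columns are the arcs of `blockMatching`. -/
def blockTableau {n p a b c : ℕ} {μ : YoungDiagram} (hμ : μ.rowLens = [p, p])
    (hp : p = a + b + c) (hn : n = 2 * (a + b + c)) : Tableau n μ where
  toFun x := ⟨(if (x : ℕ) < blockReverse a b c x then 0 else 1,
      blockIndex a b (min x (blockReverse a b c x))), by
    rw [mem_of_rowLens_eq hμ]
    refine ⟨by simp only; split_ifs <;> omega, ?_⟩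
    rw [hp]
    exact (blockIndex_min_lt hn x.2).1⟩
  invFun y := if y.1.1 = 0 then
      ⟨blockOpener a b y.1.2, (blockOpener_lt hn
        (hp ▸ ((mem_of_rowLens_eq hμ y.1).1 y.2).2)).1⟩
    else blockMatching hn ⟨blockOpener a b y.1.2, (blockOpener_lt hn
        (hp ▸ ((mem_of_rowLens_eq hμ y.1).1 y.2).2)).1⟩
  left_inv x := by
    have h := (blockIndex_min_lt hn x.2).2
    simp only [h]
    by_cases hx : (x : ℕ) < blockReverse a b c x
    · simp only [hx, if_true, min_eq_left hx.le]
    · simp only [hx, if_false, one_ne_zero, min_eq_right (not_lt.1 hx)]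
      exact (isNoncrossingMatching_blockMatching hn).apply_apply x
  right_inv y := by
    obtain ⟨⟨i, j⟩, hy⟩ := y
    have hij := (mem_of_rowLens_eq hμ (i, j)).1 hy
    simp only at hij
    obtain ⟨h1, h2, h3⟩ := blockOpener_lt hn (hp ▸ hij.2 : j < a + b + c)
    apply Subtype.ext
    by_cases hi : i = 0
    · subst hi
      simp [h2, min_eq_left h2.le, h3]
    · obtain rfl : i = 1 := by omega
      have h4 := blockReverse_blockReverse hn h1
      simp [blockMatching, h4, h2.le, h3]

theorem blockTableau_column {n p a b c : ℕ} {μ : YoungDiagram} (hμ : μ.rowLens = [p, p])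
    (hp : p = a + b + c) (hn : n = 2 * (a + b + c)) (x : Fin n) :
    (blockTableau hμ hp hn (blockMatching hn x)).1.2 = (blockTableau hμ hp hn x).1.2 := by
  change blockIndex a b (min (blockReverse a b c x) (blockReverse a b c (blockReverse a b c x))) =
    blockIndex a b (min x (blockReverse a b c x))
  rw [blockReverse_blockReverse hn x.2, min_comm]

/-! ### Counting the matchings and their dihedral orbits -/

/-- Pairs `(a, b)` with `0 < a < b < p - a - b`. -/
abbrev BlockSizes (p : ℕ) : Type :=
  {q : ℕ × ℕ // 0 < q.1 ∧ q.1 < q.2 ∧ q.1 + 2 * q.2 < p}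

instance (p : ℕ) : Finite (BlockSizes p) :=
  Finite.of_injective
    (fun q => ((⟨q.1.1, by have := q.2; omega⟩, ⟨q.1.2, by have := q.2; omega⟩) : Fin p × Fin p))
    fun q r h => by
      simp only [Prod.mk.injEq, Fin.mk.injEq] at h
      exact Subtype.ext (Prod.ext h.1 h.2)

theorem two_mul_lt_card_blockSizes {p : ℕ} (hp : 41 ≤ p) : 2 * p < Nat.card (BlockSizes p) := by
  -- Each `a` contributes about `p / 2` pairs. Six values give 87 > 82 at `p = 41`; five would give
  -- only 76.
  let S := (Finset.Icc 1 6).sigma fun a => Finset.Ico (a + 1) ((p - a + 1) / 2)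
  let e : S → BlockSizes p := fun x => ⟨(x.1.1, x.1.2), by
    have h := x.2
    simp only [S, Finset.mem_sigma, Finset.mem_Icc, Finset.mem_Ico] at h
    simp only
    omega⟩
  have he : Function.Injective e := by
    rintro ⟨⟨a, b⟩, _⟩ ⟨⟨a', b'⟩, _⟩ h
    have := congrArg Subtype.val h
    simp only [e, Prod.mk.injEq] at this
    obtain ⟨rfl, rfl⟩ := this
    rfl
  have hS : 2 * p < S.card := by
    have h6 : Finset.Icc 1 6 = ({1, 2, 3, 4, 5, 6} : Finset ℕ) := rfl
    simp only [S, Finset.card_sigma, Nat.card_Ico, h6]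
    simp
    omega
  calc 2 * p < S.card := hS
    _ = Nat.card S := by simp
    _ ≤ _ := Nat.card_le_card_of_injective e he

namespace BlockSizes

variable {n p : ℕ}

theorem eq_add (q : BlockSizes p) : p = q.1.1 + q.1.2 + (p - q.1.1 - q.1.2) := by
  have := q.2; omega

theorem two_mul_eq (hn : n = 2 * p) (q : BlockSizes p) :
    n = 2 * (q.1.1 + q.1.2 + (p - q.1.1 - q.1.2)) := by
  rw [← q.eq_add, hn]

/-- The matching with nested bundles of sizes `a`, `b`, `p - a - b`. -/
def matching (hn : n = 2 * p) (q : BlockSizes p) : Fin n → Fin n :=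
  blockMatching (q.two_mul_eq hn)

/-- The tableau with nested bundles of columns of sizes `a`, `b`, `p - a - b`. -/
def tableau (hn : n = 2 * p) {μ : YoungDiagram} (hμ : μ.rowLens = [p, p]) (q : BlockSizes p) :
    Tableau n μ :=
  blockTableau hμ q.eq_add (q.two_mul_eq hn)

/-- The image of the matching of `q` under `g`. -/
def conjMatching (hn : n = 2 * p) (g : Equiv.Perm (Fin n)) (q : BlockSizes p) (a : Fin n) :
    Fin n :=
  g (q.matching hn (g⁻¹ a))

theorem isNoncrossingMatching_conjMatching (hn : n = 2 * p) {g : Equiv.Perm (Fin n)}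
    (hg : IsDihedral g) (q : BlockSizes p) : IsNoncrossingMatching (conjMatching hn g q) :=
  (isNoncrossingMatching_blockMatching (q.two_mul_eq hn)).conj hg

/-- Gives both freeness of the orbits and their disjointness: `h⁻¹ * g` carries the matching of `q`
to that of `r`, so rigidity applies. -/
theorem conjMatching_injective (hn : n = 2 * p) {g h : Equiv.Perm (Fin n)} {q r : BlockSizes p}
    (hd : IsDihedral (h⁻¹ * g)) (e : conjMatching hn g q = conjMatching hn h r) :
    g = h ∧ q = r := by
  have hrigid := blockMatching_rigid (q.two_mul_eq hn) (r.two_mul_eq hn) q.2.1 q.2.2.1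
    (by have := q.2; omega) r.2.1 r.2.2.1 (by have := r.2; omega) hd fun a => ?_
  · have h1 := hrigid.2.2
    rw [inv_mul_eq_one] at h1
    exact ⟨h1.symm, Subtype.ext (Prod.ext hrigid.1 hrigid.2.1)⟩
  · have h1 := congrFun e (g a)
    simp only [conjMatching, matching, Equiv.Perm.coe_inv, Equiv.symm_apply_apply] at h1
    rw [Equiv.Perm.mul_apply, h1]
    exact h.symm_apply_apply _

theorem linearIndependent_polytabloid (hn : n = 2 * p) (h0 : 0 < n) {μ : YoungDiagram}
    (hμ : μ.rowLens = [p, p]) :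
    LinearIndependent ℂ fun x : dihedralSubgroup n × BlockSizes p =>
      Tableau.polytabloid (x.1.1⁻¹.trans (x.2.tableau hn hμ) : Tableau n μ) := by
  have hdih : ∀ g : dihedralSubgroup n, IsDihedral g.1 := fun g => isDihedral_of_mem h0 g.2
  have hf := fun x : dihedralSubgroup n × BlockSizes p =>
    isNoncrossingMatching_conjMatching hn (hdih x.1) x.2
  refine Tableau.linearIndependent_polytabloid
    (fun c hc => ((mem_of_rowLens_eq hμ c).1 hc).1) _ (fun x => conjMatching hn x.1.1 x.2)
    (fun x => (hf x).apply_apply) (fun x => (hf x).apply_ne) (fun x a => ?_) fun x y hxy => ?_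
  · change (x.2.tableau hn hμ (x.1.1.symm (x.1.1 (x.2.matching hn (x.1.1⁻¹ a))))).1.2 =
      (x.2.tableau hn hμ (x.1.1⁻¹ a)).1.2
    rw [Equiv.symm_apply_apply]
    exact blockTableau_column hμ x.2.eq_add (x.2.two_mul_eq hn) _
  · have e := conjMatching_injective hn (hdih (y.1⁻¹ * x.1))
      ((hf x).eq_of_openerPattern_eq (hf y) hxy)
    exact Prod.ext (Subtype.ext e.1) e.2

end BlockSizes

end

theorem proposition3p3 (n p : ℕ) (hp : p.Prime) (hp41 : 41 ≤ p) (hn : n = 2 * p)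
    (lam : YoungDiagram) (hlam : lam.rowLens = [p, p])
    {W : Type*} [AddCommGroup W] [Module ℂ W] [FiniteDimensional ℂ W]
    (σ : Representation ℂ (dihedralSubgroup n) W) (hσ : σ.IsIrreducible) :
    ∃ m : ℕ, n < m ∧
      characterInner (fun g : dihedralSubgroup n => symmetricCharacter n lam g)
        σ.character = m := by
  let ρ : Representation ℂ (dihedralSubgroup n) (spechtSubrepresentation n lam).toSubmodule :=
    (spechtSubrepresentation n lam).toRepresentation.comp (dihedralSubgroup n).subtype
  refine ⟨_, ?_, characterInner_character_eq_finrank σ ρ⟩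
  have : Nontrivial W := by
    by_contra hW
    rw [not_nontrivial_iff_subsingleton] at hW
    obtain ⟨x, y, hxy⟩ := hσ.toNontrivial
    exact hxy (Subrepresentation.toSubmodule_injective (Subsingleton.elim _ _))
  let := Fintype.ofFinite (BlockSizes p)
  let v : BlockSizes p → (spechtSubrepresentation n lam).toSubmodule := fun q =>
    ⟨(q.tableau hn hlam).polytabloid, Submodule.subset_span ⟨_, rfl⟩⟩
  have hfree : LinearIndependent ℂ fun x : dihedralSubgroup n × BlockSizes p => ρ x.1 (v x.2) := by
    refine LinearIndependent.of_comp (Submodule.subtype _) ?_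
    have h := BlockSizes.linearIndependent_polytabloid hn (by omega) hlam
    -- Polytabloids of translated tableaux are the translates of the polytabloids, which is the
    -- freeness required.
    simp only [← Tableau.ofMulAction_polytabloid] at h
    exact h
  calc n < Nat.card (BlockSizes p) := hn ▸ two_mul_lt_card_blockSizes hp41
    _ = Fintype.card (BlockSizes p) := Nat.card_eq_fintype_card
    _ ≤ _ := Representation.card_le_finrank_invariants_linHom σ ρ _ hfree
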